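/- Let $A$ be an arbitrary (not necessarily unital) C*-algebra with multiplier algebra $M(A)$, and let $RM(A)$ be the space of right multipliers of $A$; for $g\in RM(A)$ the left multiplier $g^*$ acts by $g^*a=(a^*g)^*$. Let $\ell^2(A)$ be the standard right Hilbert $A$-module of sequences $x=(x_i)_{i\in\mathbb N}$ in $A$ such that $\sum_i x_i^*x_i$ converges in norm, with $\langle x,y\rangle=\sum_i x_i^*y_i$. An $A$-functional on a right Hilbert $A$-module is a bounded $A$-homomorphism into $A$. An $A$-functional $\Gamma:\ell^2(A)\to A$ is called locally adjointable if $\Gamma\circ\gamma:A\to A$ is adjointable for every adjointable $\gamma:A\to\ell^2(A)$; the set of these is denoted $(\ell^2(A))'_{LA}$. Let $M(\ell^2(A))$ be the right Hilbert $M(A)$-module of all adjointable maps $\beta:A\to\ell^2(A)$, with $\langle r,s\rangle=r^*s$ and $(\beta\cdot m)(a)=\beta(ma)$; write $\beta_i\in M(A)$ for its coefficients, $\beta_i a=(\beta a)_i$. Let $(M(\ell^2(A)))'$ be the space of bounded $M(A)$-homomorphisms $M(\ell^2(A))\to M(A)$. A sequence $(\Gamma_i)$ in $RM(A)$ is said to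 define the element $\alpha\in(M(\ell^2(A)))'$ if all $\Gamma_i$ lie in $M(A)$ and, for every $\beta\in M(\ell^2(A))$, $\alpha(\beta)=\sum_i\Gamma_i^*\beta_i$ in the left strict topology, i.e. $\sum_i\Gamma_i^*\beta_i a$ converges in norm to $\alpha(\beta)a$ for every $a\in A$. Then: 1. Every $A$-functional $\Gamma:\ell^2(A)\to A$ has a unique coefficient sequence, i.e. there is exactly one sequence $(\Gamma_i)$ in $RM(A)$ such that $\Gamma(x)=\sum_i\Gamma_i^*x_i$, with norm convergence, for all $x\in\ell^2(A)$. 2. An $A$-functional $\Gamma:\ell^2(A)\to A$ with coefficient sequence $(\Gamma_i)$ is locally adjointable if and only if $(\Gamma_i)$ defines an element of $(M(\ell^2(A)))'$. 3. There is an isometric linear bijection $\Phi:(\ell^2(A))'_{LA}\to(M(\ell^2(A)))'$ (operator norms on both sides) such that, for every $\Gamma\in(\ell^2(A))'_{LA}$, the element $\Phi(\Gamma)$ is the one defined by the coefficient sequence of $\Gamma$, and such that $\Phi(\Gamma\cdot m)=\Phi(\Gamma)\cdot m$ for all $m\in M(A)$, where $(f\cdot m)(x)=m^*f(x)$ on both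 sides. In particular $(\ell^2(A))'_{LA}\cong(M(\ell^2(A)))'$. -/

import Mathlib

open MulOpposite Filter Topology
open scoped MultiplierAlgebra

namespace HilbertCStar

/-! ### Right pre-Hilbert modules over a C*-algebra -/

/-- A right (pre-)Hilbert `A`-module `E`; the right action `x · a` is written `op a • x`.
An element of a C*-algebra is positive iff it has the form `star b * b`; the module norm is the
given norm of `E`.  The remaining module axioms for the action of `A` follow from these laws. -/
class RightModule (A E : Type*) [NonUnitalCStarAlgebra A] [NormedAddCommGroup E]
    [NormedSpace ℂ E] [SMul Aᵐᵒᵖ E] where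
  /-- the `A`-valued inner product, linear in the second variable -/
  ip : E → E → A
  ip_add_right : ∀ x y z, ip x (y + z) = ip x y + ip x z
  ip_smul_right : ∀ (c : ℂ) x y, ip x (c • y) = c • ip x y
  ip_act_right : ∀ (a : A) x y, ip x (op a • y) = ip x y * a
  star_ip : ∀ x y, star (ip x y) = ip y x
  ip_self_nonneg : ∀ x, ∃ b : A, ip x x = star b * b
  ip_self_eq_zero : ∀ x, ip x x = 0 ↔ x = 0
  norm_eq : ∀ x, ‖x‖ = √‖ip x x‖

section Basic

variable (A : Type*) {E : Type*} [NonUnitalCStarAlgebra A] [NormedAddCommGroup E]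
  [NormedSpace ℂ E] [SMul Aᵐᵒᵖ E] [RightModule A E]

/-- The `A`-valued inner product of a right Hilbert `A`-module. -/
def ip (x y : E) : A := RightModule.ip x y

theorem ip_add_right (x y z : E) : ip A x (y + z) = ip A x y + ip A x z :=
  RightModule.ip_add_right x y z
theorem ip_smul_right (c : ℂ) (x y : E) : ip A x (c • y) = c • ip A x y :=
  RightModule.ip_smul_right c x y
theorem ip_act_right (a : A) (x y : E) : ip A x (op a • y) = ip A x y * a :=
  RightModule.ip_act_right a x y
theorem star_ip (x y : E) : star (ip A x y) = ip A y x := RightModule.star_ip x y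
theorem ip_self_eq_zero (x : E) : ip A x x = 0 ↔ x = 0 := RightModule.ip_self_eq_zero x
theorem ip_self_nonneg (x : E) : ∃ b : A, ip A x x = star b * b := RightModule.ip_self_nonneg x
theorem norm_sq_eq (x : E) : ‖x‖ ^ 2 = ‖ip A x x‖ := by
  rw [RightModule.norm_eq (A := A) x, Real.sq_sqrt (norm_nonneg _)]; rfl

theorem ip_sub_right (x y z : E) : ip A x (y - z) = ip A x y - ip A x z := by
  rw [sub_eq_add_neg, ← neg_one_smul ℂ z, ip_add_right, ip_smul_right, neg_one_smul, sub_eq_add_neg]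

theorem ext_ip {x y : E} (h : ∀ z : E, ip A z x = ip A z y) : x = y := by
  rw [← sub_eq_zero, ← ip_self_eq_zero A, ip_sub_right, h, sub_self]

theorem act_add (a : A) (x y : E) : op a • (x + y) = op a • x + op a • y :=
  ext_ip A fun z => by simp [ip_add_right, ip_act_right, add_mul]

theorem act_smul (a : A) (c : ℂ) (x : E) : op a • (c • x) = c • (op a • x) :=
  ext_ip A fun z => by simp [ip_smul_right, ip_act_right, smul_mul_assoc]

theorem act_zero (a : A) : op a • (0 : E) = 0 := by
  simpa using act_smul A a 0 (0 : E)

/-- A right Hilbert `A`-module is a C*-module over the opposite algebra in the sense of Mathlib. -/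
noncomputable abbrev toCStarModule (A : Type*) (E : Type*) [NonUnitalCStarAlgebra A]
    [NormedAddCommGroup E] [NormedSpace ℂ E] [SMul Aᵐᵒᵖ E] [RightModule A E] :
    letI := CStarAlgebra.spectralOrder Aᵐᵒᵖ
    CStarModule Aᵐᵒᵖ E :=
  letI := CStarAlgebra.spectralOrder Aᵐᵒᵖ
  haveI := CStarAlgebra.spectralOrderedRing Aᵐᵒᵖ
  { inner := fun x y => op (ip A x y)
    inner_add_right := by intro x y z; simp [ip_add_right]
    inner_self_nonneg := by
      intro x
      obtain ⟨b, hb⟩ := ip_self_nonneg A x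
      rw [hb, op_mul, op_star]
      exact mul_star_self_nonneg _
    inner_self := by intro x; simp [ip_self_eq_zero]
    inner_op_smul_right := by
      intro a x y
      rw [← op_unop a, ip_act_right]; simp
    inner_smul_right_complex := by intro z x y; simp [ip_smul_right]
    star_inner := by intro x y; rw [← op_star, star_ip]
    norm_eq_sqrt_norm_inner_self := by
      intro x
      rw [norm_op]; exact RightModule.norm_eq x }

theorem norm_ip_le (x y : E) : ‖ip A x y‖ ≤ ‖x‖ * ‖y‖ := by
  let _ := CStarAlgebra.spectralOrder Aᵐᵒᵖ
  have _ := CStarAlgebra.spectralOrderedRing Aᵐᵒᵖ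
  let _ := toCStarModule A E
  have := CStarModule.norm_inner_le (A := Aᵐᵒᵖ) E (x := x) (y := y)
  rwa [show inner Aᵐᵒᵖ x y = op (ip A x y) from rfl, norm_op] at this

end Basic

/-! ### Operators, adjointable and locally adjointable operators -/

section Operators

variable (A E F : Type*) [NonUnitalCStarAlgebra A]
  [NormedAddCommGroup E] [NormedSpace ℂ E] [SMul Aᵐᵒᵖ E] [RightModule A E]
  [NormedAddCommGroup F] [NormedSpace ℂ F] [SMul Aᵐᵒᵖ F] [RightModule A F]

/-- Operators: bounded `A`-homomorphisms `E → F`, with the operator norm. -/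
def operators : Submodule ℂ (E →L[ℂ] F) where
  carrier := {T | ∀ (a : A) (x : E), T (op a • x) = op a • T x}
  add_mem' := by
    intro S T hS hT a x
    simp only [Set.mem_ofPred_eq] at hS hT
    simp [hS, hT, act_add]
  zero_mem' := by intro a x; simp [act_zero]
  smul_mem' := by
    intro c T hT a x
    simp only [Set.mem_ofPred_eq] at hT
    simp [hT, act_smul]

variable {E F}

/-- `T` is an adjointable operator. -/
def IsAdjointable (T : E →L[ℂ] F) : Prop :=
  T ∈ operators A E F ∧
    ∃ S ∈ operators A F E, ∀ (x : E) (y : F), ip A (T x) y = ip A x (S y)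

variable {A} in
theorem IsAdjointable.add {S T : E →L[ℂ] F} (hS : IsAdjointable A S) (hT : IsAdjointable A T) :
    IsAdjointable A (S + T) := by
  obtain ⟨hS, S', hS', h⟩ := hS
  obtain ⟨hT, T', hT', k⟩ := hT
  refine ⟨add_mem hS hT, S' + T', add_mem hS' hT', fun x y => ?_⟩
  rw [← star_ip]
  simp only [add_apply, ip_add_right, star_add, star_ip, h, k]

variable {A} in
theorem IsAdjointable.smul {T : E →L[ℂ] F} (c : ℂ) (hT : IsAdjointable A T) :
    IsAdjointable A (c • T) := by
  obtain ⟨hT, T', hT', k⟩ := hT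
  refine ⟨Submodule.smul_mem _ c hT, star c • T', Submodule.smul_mem _ _ hT', fun x y => ?_⟩
  rw [← star_ip]
  simp only [smul_apply, ip_smul_right, star_smul, star_ip, k]

theorem IsAdjointable.zero : IsAdjointable A (0 : E →L[ℂ] F) := by
  refine ⟨zero_mem _, 0, zero_mem _, fun x y => ?_⟩
  have h : ip A y (0 : F) = 0 := by simpa using ip_smul_right A (0 : ℂ) y (0 : F)
  have k : ip A x (0 : E) = 0 := by simpa using ip_smul_right A (0 : ℂ) x (0 : E)
  simp only [zero_apply, k]
  rw [← star_ip, h, star_zero]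

variable {A} in
theorem IsAdjointable.comp {G : Type*} [NormedAddCommGroup G] [NormedSpace ℂ G] [SMul Aᵐᵒᵖ G]
    [RightModule A G] {T : F →L[ℂ] G} {S : E →L[ℂ] F}
    (hT : IsAdjointable A T) (hS : IsAdjointable A S) : IsAdjointable A (T ∘L S) := by
  obtain ⟨hS, S', hS', h⟩ := hS
  obtain ⟨hT, T', hT', k⟩ := hT
  refine ⟨fun a x => ?_, S' ∘L T', fun a x => ?_, fun x y => ?_⟩
  · simp [hS a x, hT a]
  · simp [hT' a x, hS' a]
  · simp [k, h]

variable {A} in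
/-- The adjoint operator `T^* : F → E` of an adjointable operator `T : E → F`. -/
noncomputable def adj {T : E →L[ℂ] F} (hT : IsAdjointable A T) : F →L[ℂ] E := hT.2.choose

variable {A} in
theorem adj_mem {T : E →L[ℂ] F} (hT : IsAdjointable A T) : adj hT ∈ operators A F E :=
  hT.2.choose_spec.1

variable {A} in
theorem ip_adj {T : E →L[ℂ] F} (hT : IsAdjointable A T) (x : E) (y : F) :
    ip A (T x) y = ip A x (adj hT y) :=
  hT.2.choose_spec.2 x y

variable {A} in
theorem ip_adj' {T : E →L[ℂ] F} (hT : IsAdjointable A T) (x : E) (y : F) :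
    ip A (adj hT y) x = ip A y (T x) := by
  rw [← star_ip, ← ip_adj, star_ip]

end Operators

/-- A C*-algebra as a right Hilbert module over itself: `⟨x, y⟩ = x^* y`. -/
instance instSelf (A : Type*) [NonUnitalCStarAlgebra A] : RightModule A A where
  ip x y := star x * y
  ip_add_right := by intros; rw [mul_add]
  ip_smul_right := by intros; rw [mul_smul_comm]
  ip_act_right := by intros; rw [op_smul_eq_mul, mul_assoc]
  star_ip := by intros; rw [star_mul, star_star]
  ip_self_nonneg := fun x => ⟨x, rfl⟩
  ip_self_eq_zero := fun x => CStarRing.star_mul_self_eq_zero_iff x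
  norm_eq := by intro x; rw [CStarRing.norm_star_mul_self, Real.sqrt_mul_self (norm_nonneg _)]

theorem ip_self_def {A : Type*} [NonUnitalCStarAlgebra A] (x y : A) : ip A x y = star x * y := rfl

section LocallyAdjointable

variable (A E F : Type*) [NonUnitalCStarAlgebra A]
  [NormedAddCommGroup E] [NormedSpace ℂ E] [SMul Aᵐᵒᵖ E] [RightModule A E]
  [NormedAddCommGroup F] [NormedSpace ℂ F] [SMul Aᵐᵒᵖ F] [RightModule A F]

variable {E F} in
/-- `T : E → F` is a locally adjointable operator: `T ∘ γ : A → F` is adjointable for every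
adjointable `γ : A → E`. -/
def IsLocallyAdjointable (T : E →L[ℂ] F) : Prop :=
  T ∈ operators A E F ∧
    ∀ γ : A →L[ℂ] E, IsAdjointable A γ → IsAdjointable A (T ∘L γ)

/-- The dual module `E'` of all (bounded) `A`-functionals `E → A`. -/
abbrev Dual : Submodule ℂ (E →L[ℂ] A) := operators A E A

/-- The module `E'_{LA}` of locally adjointable functionals. -/
def DualLA : Submodule ℂ (E →L[ℂ] A) where
  carrier := {Γ | IsLocallyAdjointable A Γ}
  add_mem' := fun hS hT => ⟨add_mem hS.1 hT.1, fun γ hγ => by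
    rw [ContinuousLinearMap.add_comp]; exact (hS.2 γ hγ).add (hT.2 γ hγ)⟩
  zero_mem' := ⟨zero_mem _, fun γ _ => by
    rw [ContinuousLinearMap.zero_comp]; exact IsAdjointable.zero A⟩
  smul_mem' := fun c _ hT => ⟨Submodule.smul_mem _ c hT.1, fun γ hγ => by
    rw [ContinuousLinearMap.smul_comp]; exact (hT.2 γ hγ).smul c⟩

variable {A E} in
/-- The right action of `A` on `E'`: `(f · a)(x) = a^* f(x)`. -/
noncomputable def Dual.act (f : Dual A E) (a : A) : Dual A E :=
  ⟨ContinuousLinearMap.mul ℂ A (star a) ∘L f.1, fun b x => by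
    simp [f.2 b x, mul_assoc]⟩

theorem isAdjointable_fst (m : 𝓜(ℂ, A)) : IsAdjointable A m.fst := by
  have key : ∀ m : 𝓜(ℂ, A), m.fst ∈ operators A A A := by
    intro m a x
    have h : ∀ z : A, z * m.fst (x * a) = z * (m.fst x * a) := fun z => by
      rw [← m.central, ← mul_assoc, ← mul_assoc, m.central]
    exact ext_ip A fun z => h (star z)
  refine ⟨key m, (star m).fst, key _, fun x y => ?_⟩
  rw [ip_self_def, ip_self_def, ← DoubleCentralizer.central, DoubleCentralizer.star_snd, star_star]

variable {A E} in
/-- The right action of the multiplier algebra on `E'_{LA}`, `(f · m)(x) = m^* f(x)`, extending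
the action `(f · a)(x) = a^* f(x)` of `A`. -/
noncomputable def DualLA.act (f : DualLA A E) (m : 𝓜(ℂ, A)) : DualLA A E :=
  ⟨(star m).fst ∘L f.1, fun a x => by
      have h1 := f.2.1 a x
      have h2 := (isAdjointable_fst A (star m)).1 a (f.1 x)
      simp only [ContinuousLinearMap.comp_apply]
      rw [h1, h2],
    fun γ hγ => by
      rw [ContinuousLinearMap.comp_assoc]
      exact (isAdjointable_fst A (star m)).comp (f.2.2 γ hγ)⟩

end LocallyAdjointable

/-! ### The standard module `ℓ²(A)` -/

section Standard

variable (A : Type*) [NonUnitalCStarAlgebra A]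

theorem summable_of_norm_sum_le {f g : ℕ → A} (hg : Summable g)
    (h : ∀ s : Finset ℕ, ‖∑ i ∈ s, f i‖ ≤ ‖∑ i ∈ s, g i‖) : Summable f := by
  rw [summable_iff_vanishing_norm] at hg ⊢
  intro ε hε
  obtain ⟨s, hs⟩ := hg ε hε
  exact ⟨s, fun t ht => (h t).trans_lt (hs t ht)⟩

/-- The sequences `x` in `A` for which `∑ x_i^* x_i` converges in norm. -/
def l2Submodule : Submodule ℂ (ℕ → A) where
  carrier := {x | Summable fun i => star (x i) * x i}
  add_mem' := by
    intro x y hx hy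
    simp only [Set.mem_ofPred_eq] at hx hy ⊢
    let _ := CStarAlgebra.spectralOrder A
    have _ := CStarAlgebra.spectralOrderedRing A
    refine summable_of_norm_sum_le A ((hx.add hy).const_smul (2 : ℕ)) fun s => ?_
    refine CStarAlgebra.norm_le_norm_of_nonneg_of_le
      (Finset.sum_nonneg fun i _ => star_mul_self_nonneg _) (Finset.sum_le_sum fun i _ => ?_)
    rw [← sub_nonneg]
    have : 2 • (star (x i) * x i + star (y i) * y i) - star ((x + y) i) * (x + y) i
        = star (x i - y i) * (x i - y i) := by
      simp only [Pi.add_apply, star_add, star_sub, add_mul, mul_add, sub_mul, mul_sub, two_smul]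
      abel
    rw [this]
    exact star_mul_self_nonneg _
  zero_mem' := by simp [summable_zero]
  smul_mem' := by
    intro c x hx
    simp only [Set.mem_ofPred_eq] at hx ⊢
    simpa [star_smul, smul_mul_smul_comm] using hx.const_smul (star c * c)

/-- The standard module `ℓ²(A)`. -/
def L2 : Type _ := l2Submodule A

noncomputable instance : AddCommGroup (L2 A) := inferInstanceAs (AddCommGroup (l2Submodule A))
noncomputable instance : Module ℂ (L2 A) := inferInstanceAs (Module ℂ (l2Submodule A))

variable {A}

/-- The coordinate `x_i` of `x ∈ ℓ²(A)`. -/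
def L2.coord (x : L2 A) (i : ℕ) : A := x.1 i

theorem L2.ext {x y : L2 A} (h : ∀ i, x.coord i = y.coord i) : x = y := Subtype.ext (funext h)

@[simp] theorem L2.coord_add (x y : L2 A) (i : ℕ) : (x + y).coord i = x.coord i + y.coord i := rfl
@[simp] theorem L2.coord_smul (c : ℂ) (x : L2 A) (i : ℕ) : (c • x).coord i = c • x.coord i := rfl
@[simp] theorem L2.coord_zero (i : ℕ) : (0 : L2 A).coord i = 0 := rfl

theorem L2.summable_self (x : L2 A) : Summable fun i => star (x.coord i) * x.coord i := x.2

theorem L2.summable (x y : L2 A) : Summable fun i => star (x.coord i) * y.coord i := by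
  have h : ∀ i, star (x.coord i) * y.coord i = (4⁻¹ : ℂ) •
      (star ((x + y).coord i) * (x + y).coord i
        - star ((x + (-1 : ℂ) • y).coord i) * (x + (-1 : ℂ) • y).coord i
        - Complex.I • (star ((x + Complex.I • y).coord i) * (x + Complex.I • y).coord i)
        + Complex.I • (star ((x + (-Complex.I) • y).coord i)
          * (x + (-Complex.I) • y).coord i)) := by
    intro i
    simp only [L2.coord_add, L2.coord_smul, star_add, star_smul, add_mul, mul_add, smul_mul_assoc,
      mul_smul_comm, smul_add, smul_sub, smul_smul, RCLike.star_def, map_neg, Complex.conj_I,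
      map_one]
    ring_nf
    simp only [Complex.I_sq]
    module
  simp_rw [h]
  exact Summable.const_smul _ ((((x + y).summable_self.sub (L2.summable_self _)).sub
    ((L2.summable_self _).const_smul _)).add ((L2.summable_self _).const_smul _))

/-- The right action `x · a` on `ℓ²(A)`, coordinatewise. -/
instance : SMul Aᵐᵒᵖ (L2 A) where
  smul a x := ⟨fun i => x.coord i * unop a, by
    have h := (x.summable_self.mul_left (star (unop a))).mul_right (unop a)
    simpa [l2Submodule, star_mul, mul_assoc] using h⟩

@[simp] theorem L2.coord_act (a : A) (x : L2 A) (i : ℕ) : (op a • x).coord i = x.coord i * a := rfl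

/-- `⟨x, y⟩ = ∑ x_i^* y_i`. -/
noncomputable def L2.inner (x y : L2 A) : A := ∑' i, star (x.coord i) * y.coord i

theorem L2.inner_self_nonneg (x : L2 A) : ∃ b : A, L2.inner x x = star b * b := by
  let _ := CStarAlgebra.spectralOrder A
  have _ := CStarAlgebra.spectralOrderedRing A
  rw [← CStarAlgebra.nonneg_iff_eq_star_mul_self]
  exact tsum_nonneg fun i => star_mul_self_nonneg _

theorem L2.inner_self_eq_zero (x : L2 A) : L2.inner x x = 0 ↔ x = 0 := by
  let _ := CStarAlgebra.spectralOrder A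
  have _ := CStarAlgebra.spectralOrderedRing A
  refine ⟨fun h => L2.ext fun i => ?_, fun h => by simp [h, L2.inner]⟩
  have h1 : HasSum (fun i => star (x.coord i) * x.coord i) 0 := h ▸ x.summable_self.hasSum
  rw [hasSum_zero_iff_of_nonneg fun i => star_mul_self_nonneg _] at h1
  exact (CStarRing.star_mul_self_eq_zero_iff _).1 (congrFun h1 i)

theorem L2.inner_add_right (x y z : L2 A) : L2.inner x (y + z) = L2.inner x y + L2.inner x z := by
  simp only [L2.inner, L2.coord_add, mul_add]
  exact (x.summable y).tsum_add (x.summable z)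

theorem L2.inner_smul_right (c : ℂ) (x y : L2 A) : L2.inner x (c • y) = c • L2.inner x y := by
  simp only [L2.inner, L2.coord_smul, mul_smul_comm]
  exact (x.summable y).tsum_const_smul c

theorem L2.inner_act_right (a : A) (x y : L2 A) : L2.inner x (op a • y) = L2.inner x y * a := by
  simp only [L2.inner, L2.coord_act, ← mul_assoc]
  exact (x.summable y).tsum_mul_right a

theorem L2.star_inner (x y : L2 A) : star (L2.inner x y) = L2.inner y x := by
  simp only [L2.inner, tsum_star, star_mul, star_star]

/-- `‖x‖ = ‖⟨x, x⟩‖^{1/2}`. -/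
noncomputable instance : Norm (L2 A) := ⟨fun x => √‖L2.inner x x‖⟩

theorem L2.normedSpaceCore : NormedSpace.Core ℂ (L2 A) :=
  letI := CStarAlgebra.spectralOrder Aᵐᵒᵖ
  haveI := CStarAlgebra.spectralOrderedRing Aᵐᵒᵖ
  letI : CStarModule Aᵐᵒᵖ (L2 A) :=
    { inner := fun x y => op (L2.inner x y)
      inner_add_right := by intro x y z; simp [L2.inner_add_right]
      inner_self_nonneg := by
        intro x
        obtain ⟨b, hb⟩ := L2.inner_self_nonneg x
        rw [hb, op_mul, op_star]
        exact mul_star_self_nonneg _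
      inner_self := by intro x; simp [L2.inner_self_eq_zero]
      inner_op_smul_right := by
        intro a x y
        rw [← op_unop a, L2.inner_act_right]; simp
      inner_smul_right_complex := by intro z x y; simp [L2.inner_smul_right]
      star_inner := by intro x y; rw [← op_star, L2.star_inner]
      norm_eq_sqrt_norm_inner_self := fun _ => rfl }
  CStarModule.normedSpaceCore Aᵐᵒᵖ

noncomputable instance : NormedAddCommGroup (L2 A) := .ofCore L2.normedSpaceCore
noncomputable instance : NormedSpace ℂ (L2 A) := .ofCore L2.normedSpaceCore

/-- The standard module `ℓ²(A)` as a right Hilbert `A`-module, `⟨x, y⟩ = ∑ x_i^* y_i`. -/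
noncomputable instance : RightModule A (L2 A) where
  ip := L2.inner
  ip_add_right := L2.inner_add_right
  ip_smul_right := L2.inner_smul_right
  ip_act_right := L2.inner_act_right
  star_ip := L2.star_inner
  ip_self_nonneg := L2.inner_self_nonneg
  ip_self_eq_zero := L2.inner_self_eq_zero
  norm_eq := fun _ => rfl

end Standard

/-! ### The multiplier module `M(N)` -/

section MultiplierModule

variable (A N : Type*) [NonUnitalCStarAlgebra A]
  [NormedAddCommGroup N] [NormedSpace ℂ N] [SMul Aᵐᵒᵖ N] [RightModule A N]

/-- The multiplier module `M(N)`: the adjointable maps `A → N`, with the operator norm. -/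
def MultiplierModule : Submodule ℂ (A →L[ℂ] N) where
  carrier := {r | IsAdjointable A r}
  add_mem' := fun hS hT => hS.add hT
  zero_mem' := IsAdjointable.zero A
  smul_mem' := fun c _ hT => hT.smul c

variable {A N}

/-- The right action of `M(A)` on `M(N)`: `(r · m)(a) = r (m a)`. -/
instance : SMul (𝓜(ℂ, A))ᵐᵒᵖ (MultiplierModule A N) where
  smul m r := ⟨r.1 ∘L (unop m).fst, IsAdjointable.comp r.2 (isAdjointable_fst A (unop m))⟩

@[simp] theorem MultiplierModule.act_apply (m : 𝓜(ℂ, A)) (r : MultiplierModule A N) (a : A) :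
    (op m • r).1 a = r.1 (m.fst a) := rfl

theorem fst_star_ip (r s : A →L[ℂ] N) (hr : IsAdjointable A r) (hs : IsAdjointable A s) (x y : A) :
    star (adj hs (r (star x))) * y = x * adj hr (s y) := by
  have h1 := ip_adj' hs y (r (star x))
  have h2 := ip_adj hr (star x) (s y)
  simp only [ip_self_def] at h2
  rw [ip_self_def] at h1
  rw [h1, h2, star_star]

/-- The `M(A)`-valued inner product `⟨r, s⟩ = r^* s` of `M(N)`, i.e. `⟨r, s⟩ a = r^*(s a)`. -/
noncomputable def MultiplierModule.inner (r s : MultiplierModule A N) : 𝓜(ℂ, A) where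
  fst := adj r.2 ∘L s.1
  snd := (((starₗᵢ ℂ : A ≃ₗᵢ⋆[ℂ] A) : A →L⋆[ℂ] A).comp (adj s.2 ∘L r.1)).comp
          ((starₗᵢ ℂ : A ≃ₗᵢ⋆[ℂ] A) : A →L⋆[ℂ] A)
  central := fun x y => fst_star_ip r.1 s.1 r.2 s.2 x y

@[simp] theorem MultiplierModule.inner_fst (r s : MultiplierModule A N) (a : A) :
    (MultiplierModule.inner r s).fst a = adj r.2 (s.1 a) := rfl

theorem multiplier_ext {m n : 𝓜(ℂ, A)} (h : ∀ a, m.fst a = n.fst a) : m = n := by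
  refine DoubleCentralizer.ext ℂ A _ _ (Prod.ext (ContinuousLinearMap.ext h)
    (ContinuousLinearMap.ext fun x => ?_))
  have : ∀ y, m.snd x * y = n.snd x * y := fun y => by rw [m.central, n.central, h]
  have h2 : (m.snd x - n.snd x) * star (m.snd x - n.snd x) = 0 := by
    rw [sub_mul, this, sub_self]
  exact sub_eq_zero.1 ((CStarRing.mul_star_self_eq_zero_iff _).1 h2)

theorem MultiplierModule.ip_inner (r s : MultiplierModule A N) (a b : A) :
    ip A (r.1 a) (s.1 b) = star a * (MultiplierModule.inner r s).fst b := by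
  rw [ip_adj r.2, ip_self_def]; rfl

theorem MultiplierModule.inner_ext {r s : MultiplierModule A N} {m : 𝓜(ℂ, A)}
    (h : ∀ a b, ip A (r.1 a) (s.1 b) = star a * m.fst b) : MultiplierModule.inner r s = m :=
  multiplier_ext fun b => ext_ip A fun a => by
    rw [ip_self_def, ip_self_def, ← h, MultiplierModule.ip_inner]

theorem MultiplierModule.star_inner (r s : MultiplierModule A N) :
    star (MultiplierModule.inner r s) = MultiplierModule.inner s r := by
  refine (MultiplierModule.inner_ext fun a b => ?_).symm
  rw [DoubleCentralizer.star_fst, ← star_mul, ← star_ip, MultiplierModule.ip_inner]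
  congr 1
  rw [DoubleCentralizer.central]

theorem multiplier_nonneg {h : 𝓜(ℂ, A)} (hs : star h = h)
    (hh : ∀ a : A, ∃ b : A, star a * h.fst a = star b * b) : ∃ c : 𝓜(ℂ, A), h = star c * c := by
  let _ := CStarAlgebra.spectralOrder A
  have _ := CStarAlgebra.spectralOrderedRing A
  let _ := CStarAlgebra.spectralOrder 𝓜(ℂ, A)
  have _ := CStarAlgebra.spectralOrderedRing 𝓜(ℂ, A)
  have hsa : IsSelfAdjoint h := hs
  set p := h⁻ with hp
  have hp0 : 0 ≤ p := CFC.negPart_nonneg h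
  have hps : star p = p := (IsSelfAdjoint.of_nonneg hp0)
  have hph : p * h * p = - (p * p * p) := by
    have h1 : h⁺ * p = 0 := CFC.posPart_mul_negPart h
    have h2 : h = h⁺ - p := (CFC.posPart_sub_negPart h hsa).symm
    have h3 : h * p = - (p * p) := by
      calc h * p = (h⁺ - p) * p := by rw [← h2]
        _ = - (p * p) := by rw [sub_mul, h1, zero_sub]
    rw [mul_assoc, h3, mul_neg, mul_assoc]
  have hp3 : 0 ≤ p * p * p := by
    have := star_left_conjugate_nonneg hp0 p
    rwa [hps] at this
  obtain ⟨c, hc⟩ := CStarAlgebra.nonneg_iff_eq_star_mul_self.1 hp3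
  have hfst : ∀ (m : 𝓜(ℂ, A)) (a : A), star (m.fst a) * m.fst a = star a * (star m * m).fst a := by
    intro m a
    rw [DoubleCentralizer.mul_fst]
    have := DoubleCentralizer.central (star m) (star a) (m.fst a)
    rw [DoubleCentralizer.star_snd, star_star] at this
    exact this
  have hc0 : ∀ a, c.fst a = 0 := by
    intro a
    obtain ⟨b, hb⟩ := hh (p.fst a)
    have h1 : star (p.fst a) * h.fst (p.fst a) = star a * (p * h * p).fst a := by
      have := DoubleCentralizer.central (star p) (star a) (h.fst (p.fst a))
      rw [DoubleCentralizer.star_snd, star_star, hps] at this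
      exact this
    rw [hph, hc] at h1
    have h2 : star b * b = - (star (c.fst a) * c.fst a) := by
      rw [← hb, h1, hfst, ← mul_neg (star a)]; rfl
    have h3 : star (c.fst a) * c.fst a ≤ 0 := by
      rw [← neg_nonneg, ← h2]; exact star_mul_self_nonneg _
    exact (CStarRing.star_mul_self_eq_zero_iff _).1 (le_antisymm h3 (star_mul_self_nonneg _))
  have hc' : c = 0 := multiplier_ext hc0
  rw [hc', mul_zero] at hc
  have h4 : star (p * p) * (p * p) = 0 := by
    rw [star_mul, hps, ← mul_assoc, hc, zero_mul]
  have h5 : star p * p = 0 := by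
    rw [hps]; exact (CStarRing.star_mul_self_eq_zero_iff _).1 h4
  have h6 : p = 0 := (CStarRing.star_mul_self_eq_zero_iff _).1 h5
  have h7 : 0 ≤ h := by
    have h2 : h = h⁺ - p := (CFC.posPart_sub_negPart h hsa).symm
    rw [h2, h6, sub_zero]
    exact CFC.posPart_nonneg h
  exact CStarAlgebra.nonneg_iff_eq_star_mul_self.1 h7

theorem norm_adj_le {T : A →L[ℂ] N} (hT : IsAdjointable A T) : ‖adj hT‖ ≤ ‖T‖ := by
  refine ContinuousLinearMap.opNorm_le_bound _ (norm_nonneg _) fun y => ?_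
  have h : ‖adj hT y‖ ^ 2 ≤ ‖T‖ * ‖adj hT y‖ * ‖y‖ := by
    rw [norm_sq_eq A, ← ip_adj]
    exact (norm_ip_le A _ _).trans (mul_le_mul_of_nonneg_right (T.le_opNorm _) (norm_nonneg _))
  by_cases h0 : ‖adj hT y‖ = 0
  · rw [h0]; positivity
  · have : 0 < ‖adj hT y‖ := lt_of_le_of_ne (norm_nonneg _) (Ne.symm h0)
    nlinarith

theorem MultiplierModule.norm_sq (r : MultiplierModule A N) :
    ‖r‖ ^ 2 = ‖MultiplierModule.inner r r‖ := by
  apply le_antisymm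
  · refine (Real.le_sqrt (norm_nonneg r) (norm_nonneg _)).1 ?_
    refine ContinuousLinearMap.opNorm_le_bound _ (Real.sqrt_nonneg _) fun a => ?_
    change ‖r.1 a‖ ≤ _
    refine le_of_sq_le_sq ?_ (by positivity)
    rw [norm_sq_eq A, MultiplierModule.ip_inner, mul_pow, Real.sq_sqrt (norm_nonneg _)]
    refine (norm_mul_le _ _).trans ?_
    rw [norm_star, ← DoubleCentralizer.norm_fst]
    have := (MultiplierModule.inner r r).fst.le_opNorm a
    nlinarith [norm_nonneg a]
  · rw [← DoubleCentralizer.norm_fst]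
    refine (ContinuousLinearMap.opNorm_comp_le (adj r.2) r.1).trans ?_
    rw [sq]
    exact mul_le_mul_of_nonneg_right (norm_adj_le r.2) (norm_nonneg _)

/-- `M(N)` is a right Hilbert `M(A)`-module with inner product `⟨r, s⟩ = r^* s`. -/
noncomputable instance : RightModule 𝓜(ℂ, A) (MultiplierModule A N) where
  ip := MultiplierModule.inner
  ip_add_right := fun r s t => MultiplierModule.inner_ext fun a b => by
    change ip A (r.1 a) (s.1 b + t.1 b) =
      star a * ((MultiplierModule.inner r s).fst b + (MultiplierModule.inner r t).fst b)
    rw [ip_add_right, mul_add, MultiplierModule.ip_inner, MultiplierModule.ip_inner]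
  ip_smul_right := fun c r s => MultiplierModule.inner_ext fun a b => by
    change ip A (r.1 a) (c • s.1 b) = star a * (c • (MultiplierModule.inner r s).fst b)
    rw [ip_smul_right, mul_smul_comm, MultiplierModule.ip_inner]
  ip_act_right := fun m r s => MultiplierModule.inner_ext fun a b => by
    rw [MultiplierModule.act_apply, MultiplierModule.ip_inner]; rfl
  star_ip := MultiplierModule.star_inner
  ip_self_nonneg := fun r => multiplier_nonneg (MultiplierModule.star_inner r r) fun a => by
    rw [← MultiplierModule.ip_inner]; exact ip_self_nonneg A _
  ip_self_eq_zero := fun r => by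
    rw [← norm_eq_zero, ← MultiplierModule.norm_sq]; simp
  norm_eq := fun r => by rw [← MultiplierModule.norm_sq, Real.sqrt_sq (norm_nonneg r)]

end MultiplierModule

/-! ### Coefficients -/

section Coefficients

variable (A : Type*) [NonUnitalCStarAlgebra A]

/-- `RM(A)`: right multipliers, i.e. bounded maps `a ↦ a g` with `(b a) g = b (a g)`. -/
def RM : Submodule ℂ (A →L[ℂ] A) where
  carrier := {g | ∀ b a : A, g (b * a) = b * g a}
  add_mem' := by
    intro S T hS hT b a
    simp only [Set.mem_ofPred_eq] at hS hT
    simp [hS, hT, mul_add]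
  zero_mem' := by intro b a; simp
  smul_mem' := by
    intro c T hT b a
    simp only [Set.mem_ofPred_eq] at hT
    simp [hT, mul_smul_comm]

variable {A}

/-- The left multiplier `g^* ∈ LM(A)` of a right multiplier `g`, applied to `a`:
`g^* a = (a^* g)^*`. -/
def RM.starMul (g : RM A) (a : A) : A := star (g.1 (star a))

/-- The inclusion `M(A) ⊆ RM(A)`. -/
def RM.ofMultiplier (m : 𝓜(ℂ, A)) : RM A :=
  ⟨m.snd, fun b a => by
    have h : ∀ z, m.snd (b * a) * z = b * m.snd a * z := fun z => by
      rw [m.central, mul_assoc, mul_assoc, m.central]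
    have h2 : (m.snd (b * a) - b * m.snd a) * star (m.snd (b * a) - b * m.snd a) = 0 := by
      rw [sub_mul, h, sub_self]
    exact sub_eq_zero.1 ((CStarRing.mul_star_self_eq_zero_iff _).1 h2)⟩

/-- `(g_i)` is the coefficient sequence of the functional `Γ : ℓ²(A) → A`:
`Γ x = ∑ g_i^* x_i` with norm convergence, for all `x`. -/
def IsCoeff (Γ : Dual A (L2 A)) (g : ℕ → RM A) : Prop :=
  ∀ x : L2 A, Tendsto (fun n => ∑ i ∈ Finset.range n, RM.starMul (g i) (x.coord i)) atTop (𝓝 (Γ.1 x))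

/-- The sequence `(g_i)` in `RM(A)` defines the element `α` of `(M(ℓ²(A)))'`: every `g_i` is a
two-sided multiplier `m_i ∈ M(A)`, and for every `β ∈ M(ℓ²(A))`, with coefficients
`β_i ∈ M(A)`, `β_i a = (β a)_i`, one has `α β = ∑ m_i^* β_i`, the series converging left strictly,
i.e. in norm after being applied to any `a ∈ A`. -/
def Defines (g : ℕ → RM A) (α : Dual 𝓜(ℂ, A) (MultiplierModule A (L2 A))) : Prop :=
  ∃ m : ℕ → 𝓜(ℂ, A), (∀ i, RM.ofMultiplier (m i) = g i) ∧
    ∀ (β : MultiplierModule A (L2 A)) (a : A),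
      Tendsto (fun n => ∑ i ∈ Finset.range n, (star (m i)).fst ((β.1 a).coord i)) atTop
        (𝓝 ((α.1 β).fst a))

end Coefficients

end HilbertCStar

/-! The isometry holds for every module `N`, not only for `ℓ²(A)`. Sending `x` to `a ↦ x · a` embeds
`N` in `M(N)`, and each `β` in `M(N)` satisfies `β · a = β a` under this embedding, for `a` in `A`.
So `α (β a) = α(β) a` for a functional `α` on `M(N)`: its values on `N` determine it, and since `A`
is an ideal of `M(A)` these values lie in `A`, first on vectors `x · e` and then, by an approximate
unit, on all of `N` (`apply_toMultiplierModule_mem_range`). Moreover `α|_N ∘ β` is left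
multiplication by the multiplier `α(β)`, hence adjointable, so `α|_N` is locally adjointable.
Conversely, if `Γ` is locally adjointable, then `Γ ∘ β` is a multiplier and `β ↦ Γ ∘ β` extends `Γ`.
These two passages are inverse to each other (`dualLAEquiv`).

For `ℓ²(A)`, every `x` is the norm limit of its truncations (`L2.tendsto_sum_single`). Applying `Γ`
gives the coefficient series, and taking `x = β a` gives the left strict series for `Γ ∘ β`. -/

namespace HilbertCStar

/-! ### The operators `a ↦ x · a` and the embedding of `N` in `M(N)`. -/

section Rank

variable {A N : Type*} [NonUnitalCStarAlgebra A]
  [NormedAddCommGroup N] [NormedSpace ℂ N] [SMul Aᵐᵒᵖ N] [RightModule A N]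

theorem ip_sub_left (x y z : N) : ip A (x - y) z = ip A x z - ip A y z := by
  rw [← star_ip, ip_sub_right, star_sub, star_ip, star_ip]

theorem ip_act_left (a : A) (x y : N) : ip A (op a • x) y = star a * ip A x y := by
  rw [← star_ip, ip_act_right, star_mul, star_ip]

theorem norm_act_le (a : A) (x : N) : ‖op a • x‖ ≤ ‖x‖ * ‖a‖ := by
  refine le_of_sq_le_sq ?_ (by positivity)
  rw [norm_sq_eq A, ip_act_right, ip_act_left]
  refine (norm_mul_le _ _).trans ((mul_le_mul_of_nonneg_right (norm_mul_le _ _)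
    (norm_nonneg _)).trans (le_of_eq ?_))
  rw [norm_star, ← norm_sq_eq A]
  ring

/-- The adjoint `y ↦ ⟨x, y⟩` of `a ↦ x · a`. -/
noncomputable def ipCLM (x : N) : N →L[ℂ] A :=
  LinearMap.mkContinuous
    { toFun := fun y => ip A x y
      map_add' := ip_add_right A x
      map_smul' := fun c y => ip_smul_right A c x y } ‖x‖ (norm_ip_le A x)

/-- These laws of the action are not axioms of `RightModule`; they follow because inner products
separate points. -/
theorem act_add_left (x : N) (a b : A) : op (a + b) • x = op a • x + op b • x :=
  ext_ip A fun z => by simp only [ip_add_right, ip_act_right, mul_add]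

theorem act_smul_left (x : N) (c : ℂ) (a : A) : op (c • a) • x = c • (op a • x) :=
  ext_ip A fun z => by simp only [ip_smul_right, ip_act_right, mul_smul_comm]

theorem act_mul (x : N) (a b : A) : op (a * b) • x = op b • (op a • x) :=
  ext_ip A fun z => by simp only [ip_act_right, mul_assoc]

variable (A) in
/-- The operator `a ↦ x · a` from `A` to `N`. -/
noncomputable def actCLM (x : N) : A →L[ℂ] N :=
  LinearMap.mkContinuous
    { toFun := fun a => op a • x
      map_add' := act_add_left x
      map_smul' := act_smul_left x } ‖x‖ fun a => norm_act_le a x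

@[simp] theorem actCLM_apply (x : N) (a : A) : actCLM A x a = op a • x := rfl

theorem norm_actCLM_le (x : N) : ‖actCLM A x‖ ≤ ‖x‖ :=
  LinearMap.mkContinuous_norm_le _ (norm_nonneg x) fun a => norm_act_le a x

theorem isAdjointable_actCLM (x : N) : IsAdjointable A (actCLM A x) :=
  ⟨fun a b => act_mul x b a, ipCLM x, fun a y => ip_act_right A a x y, fun a y => by
    rw [actCLM_apply, ip_act_left]; rfl⟩

/-- The embedding `N → M(N)` sending `x` to `a ↦ x · a`. -/
noncomputable def toMultiplierModule : N →L[ℂ] MultiplierModule A N :=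
  LinearMap.mkContinuous
    { toFun := fun x => ⟨actCLM A x, isAdjointable_actCLM x⟩
      map_add' := fun x y => Subtype.ext (ContinuousLinearMap.ext fun a => act_add A a x y)
      map_smul' := fun c x => Subtype.ext (ContinuousLinearMap.ext fun a => act_smul A a c x) }
    1 fun x => by
      rw [one_mul]
      exact norm_actCLM_le x

theorem norm_toMultiplierModule_le (x : N) : ‖toMultiplierModule (A := A) x‖ ≤ ‖x‖ :=
  norm_actCLM_le x

/-- This is `β (a b) = β a · b`. It lets the `M(A)`-linearity of a functional on `M(N)` be used on
vectors of `N`. -/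
theorem toMultiplierModule_apply_eq_act (β : MultiplierModule A N) (a : A) :
    toMultiplierModule (β.1 a) = op (a : 𝓜(ℂ, A)) • β :=
  Subtype.ext (ContinuousLinearMap.ext fun b => (β.2.1 b a).symm)

theorem toMultiplierModule_act (x : N) (a : A) :
    toMultiplierModule (op a • x) = op (a : 𝓜(ℂ, A)) • toMultiplierModule (A := A) x :=
  toMultiplierModule_apply_eq_act (toMultiplierModule x) a

-- With `h = ⟨x, x⟩`, the square of `‖x · e - x‖` is the norm of `e^* (h e - h) - (h e - h)`, at
-- most `2 ‖h e - h‖` when `‖e‖ ≤ 1`; an approximate unit sends this to zero. The filter is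
-- existential so that the spectral order on `A` stays inside the proof.
variable (A) in
theorem exists_tendsto_act (x : N) : ∃ l : Filter A, l.NeBot ∧
    Tendsto (fun e => op e • x) l (𝓝 x) := by
  let _ := CStarAlgebra.spectralOrder A
  have _ := CStarAlgebra.spectralOrderedRing A
  have hl := CStarAlgebra.increasingApproximateUnit A
  refine ⟨CStarAlgebra.approximateUnit A, hl.neBot, ?_⟩
  rw [tendsto_iff_norm_sub_tendsto_zero]
  have h1 : Tendsto (fun e => √(2 * ‖ip A x x * e - ip A x x‖))
      (CStarAlgebra.approximateUnit A) (𝓝 0) := by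
    have h := tendsto_iff_norm_sub_tendsto_zero.1 (hl.tendsto_mul_left (ip A x x))
    simpa using (h.const_mul 2).sqrt
  refine squeeze_zero' (Eventually.of_forall fun _ => norm_nonneg _) ?_ h1
  filter_upwards [hl.eventually_norm] with e he
  refine Real.le_sqrt_of_sq_le ?_
  have h2 : ip A (op e • x - x) (op e • x - x)
      = star e * (ip A x x * e - ip A x x) - (ip A x x * e - ip A x x) := by
    simp only [ip_sub_left, ip_sub_right, ip_act_left, ip_act_right, mul_sub, sub_mul,
      mul_assoc]
    abel
  rw [norm_sq_eq A, h2, two_mul]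
  refine (norm_sub_le _ _).trans (add_le_add_left ((norm_mul_le _ _).trans ?_) _)
  rw [norm_star]
  exact mul_le_of_le_one_left (norm_nonneg _) he

end Rank

/-! ### Multipliers as adjointable operators on `A`, and `A` as an ideal of `M(A)`. -/

section Multiplier

variable {A : Type*} [NonUnitalCStarAlgebra A]

/-- An adjointable operator on `A` as a multiplier of `A`. -/
noncomputable def multiplierOfAdjointable (T : A →L[ℂ] A) (hT : IsAdjointable A T) : 𝓜(ℂ, A) where
  fst := T
  snd := (((starₗᵢ ℂ : A ≃ₗᵢ⋆[ℂ] A) : A →L⋆[ℂ] A).comp (adj hT)).comp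
          ((starₗᵢ ℂ : A ≃ₗᵢ⋆[ℂ] A) : A →L⋆[ℂ] A)
  -- The right half is `x ↦ (T^* x^*)^*`, so centrality is the adjunction relation at `x^*`.
  central := fun x y => by
    have h := ip_adj' hT y (star x)
    simp only [ip_self_def, star_star] at h
    exact h

theorem norm_coe_multiplier (a : A) : ‖(a : 𝓜(ℂ, A))‖ = ‖a‖ := by
  rw [← DoubleCentralizer.norm_fst, DoubleCentralizer.coe_fst]
  exact (ContinuousLinearMap.isometry_mul ℂ A).norm_map_of_map_zero (map_zero _) a

/-- Since `m (a b) = (m a) b`, the product is again left multiplication by an element of `A`. This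
ideal property forces functionals on `M(N)` to take values in `A` on `N`. -/
theorem multiplier_mul_coe (m : 𝓜(ℂ, A)) (a : A) : m * (a : 𝓜(ℂ, A)) = (m.fst a : A) :=
  multiplier_ext fun b => (isAdjointable_fst A m).1 b a

variable (A) in
/-- The isometric inclusion of `A` in `M(A)`. -/
noncomputable def coeMultiplier : A →ₗᵢ[ℂ] 𝓜(ℂ, A) where
  toFun a := a
  map_add' a b := map_add (DoubleCentralizer.coeHom (𝕜 := ℂ) (A := A)) a b
  map_smul' c a := map_smul (DoubleCentralizer.coeHom (𝕜 := ℂ) (A := A)) c a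
  norm_map' := norm_coe_multiplier

@[simp] theorem coeMultiplier_apply (a : A) : coeMultiplier A a = (a : 𝓜(ℂ, A)) := rfl

theorem RM.starMul_ofMultiplier (m : 𝓜(ℂ, A)) (a : A) :
    RM.starMul (RM.ofMultiplier m) a = (star m).fst a :=
  (DoubleCentralizer.star_fst m a).symm

end Multiplier

/-! ### Locally adjointable functionals on `N` and functionals on `M(N)`. -/

section Duality

variable {A N : Type*} [NonUnitalCStarAlgebra A]
  [NormedAddCommGroup N] [NormedSpace ℂ N] [SMul Aᵐᵒᵖ N] [RightModule A N]

/-- The functional `β ↦ Γ ∘ β` on `M(N)` induced by a locally adjointable functional `Γ`. -/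
noncomputable def DualLA.extend (Γ : DualLA A N) : Dual 𝓜(ℂ, A) (MultiplierModule A N) :=
  ⟨LinearMap.mkContinuous
    { toFun := fun β => multiplierOfAdjointable (Γ.1 ∘L β.1) (Γ.2.2 β.1 β.2)
      map_add' := fun β γ => multiplier_ext fun a => map_add Γ.1 (β.1 a) (γ.1 a)
      map_smul' := fun c β => multiplier_ext fun a => map_smul Γ.1 c (β.1 a) } ‖Γ.1‖ fun β => by
        rw [← DoubleCentralizer.norm_fst]
        exact ContinuousLinearMap.opNorm_comp_le Γ.1 β.1,
    -- Both sides send `a` to `Γ (β (m a))`.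
    fun _ _ => multiplier_ext fun _ => rfl⟩

theorem DualLA.extend_toMultiplierModule (Γ : DualLA A N) (x : N) :
    (DualLA.extend Γ).1 (toMultiplierModule x) = (Γ.1 x : A) :=
  multiplier_ext fun a => Γ.2.1 a x

/-- Composition with `Γ` cannot exceed its norm. Conversely, `Γ` is recovered on `N`, where `N →
M(N)` is contractive and `A → M(A)` is isometric. -/
theorem DualLA.norm_extend (Γ : DualLA A N) : ‖DualLA.extend Γ‖ = ‖Γ‖ := by
  apply le_antisymm
  · refine ContinuousLinearMap.opNorm_le_bound _ (norm_nonneg _) fun β => ?_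
    rw [← DoubleCentralizer.norm_fst]
    exact ContinuousLinearMap.opNorm_comp_le Γ.1 β.1
  · refine ContinuousLinearMap.opNorm_le_bound _ (norm_nonneg _) fun x => ?_
    change ‖Γ.1 x‖ ≤ _
    rw [← norm_coe_multiplier, ← DualLA.extend_toMultiplierModule]
    exact ((DualLA.extend Γ).1.le_opNorm _).trans
      (mul_le_mul_of_nonneg_left (norm_toMultiplierModule_le x) (ContinuousLinearMap.opNorm_nonneg _))

theorem apply_toMultiplierModule_apply (α : Dual 𝓜(ℂ, A) (MultiplierModule A N))
    (β : MultiplierModule A N) (a : A) :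
    α.1 (toMultiplierModule (β.1 a)) = coeMultiplier A ((α.1 β).fst a) := by
  rw [toMultiplierModule_apply_eq_act, α.2, op_smul_eq_mul, multiplier_mul_coe,
    coeMultiplier_apply]

/-- Vectors `x · e` go into `A` by the ideal property, they approximate `x`, and `A`, being
complete, is closed in `M(A)`. -/
theorem apply_toMultiplierModule_mem_range (α : Dual 𝓜(ℂ, A) (MultiplierModule A N)) (x : N) :
    α.1 (toMultiplierModule x) ∈ LinearMap.range (coeMultiplier A).toLinearMap := by
  obtain ⟨l, _, hl⟩ := exists_tendsto_act A x
  have hc : IsClosed (Set.range (coeMultiplier A)) :=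
    (coeMultiplier A).isometry.isClosedEmbedding.isClosed_range
  refine hc.mem_of_tendsto (((α.1 ∘L toMultiplierModule).continuous.tendsto x).comp hl)
    (Eventually.of_forall fun e => ?_)
  exact ⟨_, (apply_toMultiplierModule_apply α (toMultiplierModule x) e).symm⟩

/-- The restriction to `N` of a functional on `M(N)`. -/
noncomputable def restrict (α : Dual 𝓜(ℂ, A) (MultiplierModule A N)) : N →L[ℂ] A :=
  ((coeMultiplier A).equivRange.symm : _ →L[ℂ] A) ∘L
    (α.1 ∘L toMultiplierModule).codRestrict _ (apply_toMultiplierModule_mem_range α)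

theorem coe_restrict (α : Dual 𝓜(ℂ, A) (MultiplierModule A N)) (x : N) :
    coeMultiplier A (restrict α x) = α.1 (toMultiplierModule x) :=
  congrArg Subtype.val ((coeMultiplier A).equivRange.apply_symm_apply _)

/-- A multiplier is known from its action on `A`, so `α` is recovered from its restriction to `N`.
-/
theorem restrict_apply (α : Dual 𝓜(ℂ, A) (MultiplierModule A N)) (β : MultiplierModule A N)
    (a : A) : restrict α (β.1 a) = (α.1 β).fst a :=
  (coeMultiplier A).injective (by rw [coe_restrict, apply_toMultiplierModule_apply])

/-- Composed with `γ`, the restriction becomes the left half of the multiplier `α(γ)`, which is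
adjointable. -/
theorem isLocallyAdjointable_restrict (α : Dual 𝓜(ℂ, A) (MultiplierModule A N)) :
    IsLocallyAdjointable A (restrict α) := by
  refine ⟨fun a x => (coeMultiplier A).injective ?_, fun γ hγ => ?_⟩
  · rw [coe_restrict, toMultiplierModule_act, α.2, ← coe_restrict, op_smul_eq_mul, op_smul_eq_mul]
    exact (map_mul (DoubleCentralizer.coeHom (𝕜 := ℂ) (A := A)) _ _).symm
  · have h : restrict α ∘L γ = (α.1 ⟨γ, hγ⟩).fst :=
      ContinuousLinearMap.ext fun a => restrict_apply α ⟨γ, hγ⟩ a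
    rw [h]
    exact isAdjointable_fst A _

variable (A N) in
/-- Locally adjointable functionals on `N` are the functionals on `M(N)`. -/
noncomputable def dualLAEquiv : DualLA A N ≃ₗᵢ[ℂ] Dual 𝓜(ℂ, A) (MultiplierModule A N) where
  toFun := DualLA.extend
  invFun α := ⟨restrict α, isLocallyAdjointable_restrict α⟩
  map_add' _ _ := Subtype.ext (ContinuousLinearMap.ext fun _ => multiplier_ext fun _ => rfl)
  map_smul' _ _ := Subtype.ext (ContinuousLinearMap.ext fun _ => multiplier_ext fun _ => rfl)
  left_inv Γ := Subtype.ext (ContinuousLinearMap.ext fun x => (coeMultiplier A).injective (by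
    rw [coe_restrict, DualLA.extend_toMultiplierModule, coeMultiplier_apply]))
  right_inv α := Subtype.ext (ContinuousLinearMap.ext fun β => multiplier_ext fun a =>
    restrict_apply α β a)
  norm_map' := DualLA.norm_extend

theorem dualLAEquiv_apply_fst (Γ : DualLA A N) (β : MultiplierModule A N) (a : A) :
    ((dualLAEquiv A N Γ).1 β).fst a = Γ.1 (β.1 a) := rfl

theorem dualLAEquiv_act (Γ : DualLA A N) (m : 𝓜(ℂ, A)) :
    dualLAEquiv A N (DualLA.act Γ m) = Dual.act (dualLAEquiv A N Γ) m :=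
  Subtype.ext (ContinuousLinearMap.ext fun _ => multiplier_ext fun _ => rfl)

end Duality

/-! ### Coordinates and truncations in `ℓ²(A)`. -/

section StandardModule

variable {A : Type*} [NonUnitalCStarAlgebra A]

theorem L2.ip_eq_tsum (x y : L2 A) : ip A x y = ∑' i, star (x.coord i) * y.coord i := rfl

/-- The element of `ℓ²(A)` with entry `a` in position `i` and zeros elsewhere. -/
noncomputable def L2.single (i : ℕ) (a : A) : L2 A :=
  ⟨Pi.single i a, summable_of_ne_finset_zero (s := {i}) fun j hj => by
    rw [Pi.single_eq_of_ne (by simpa using hj), mul_zero]⟩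

theorem L2.coord_single_of_ne {i j : ℕ} (a : A) (h : j ≠ i) : (L2.single i a).coord j = 0 :=
  Pi.single_eq_of_ne (M := fun _ => A) h a

@[simp] theorem L2.coord_single_self (i : ℕ) (a : A) : (L2.single i a).coord i = a :=
  Pi.single_eq_same (M := fun _ => A) i a

theorem L2.ip_single_left (i : ℕ) (a : A) (x : L2 A) :
    ip A (L2.single i a) x = star a * x.coord i := by
  rw [L2.ip_eq_tsum, tsum_eq_single i fun j hj => by
    rw [L2.coord_single_of_ne a hj, star_zero, zero_mul], L2.coord_single_self]

theorem L2.norm_single (i : ℕ) (a : A) : ‖L2.single i a‖ = ‖a‖ := by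
  rw [← sq_eq_sq₀ (norm_nonneg _) (norm_nonneg _), norm_sq_eq A, L2.ip_single_left,
    L2.coord_single_self, CStarRing.norm_star_mul_self, sq]

/-- The inclusion of `A` in `ℓ²(A)` as the `i`-th summand. -/
noncomputable def L2.singleCLM (i : ℕ) : A →L[ℂ] L2 A :=
  LinearMap.mkContinuous
    { toFun := L2.single i
      map_add' := fun a b => Subtype.ext (Pi.single_add (f := fun _ => A) i a b)
      map_smul' := fun c a => Subtype.ext (Pi.single_smul (f := fun _ => A) i c a) } 1 fun a => by
    rw [one_mul]; exact (L2.norm_single i a).le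

/-- Cauchy–Schwarz against the vector with single entry `x_i` gives `‖x_i‖² ≤ ‖x_i‖ ‖x‖`. -/
theorem L2.norm_coord_le (x : L2 A) (i : ℕ) : ‖x.coord i‖ ≤ ‖x‖ := by
  have h := norm_ip_le A (L2.single i (x.coord i)) x
  rw [L2.ip_single_left, L2.norm_single, CStarRing.norm_star_mul_self] at h
  rcases (norm_nonneg (x.coord i)).eq_or_lt with h0 | h0
  · rw [← h0]; exact norm_nonneg x
  · exact le_of_mul_le_mul_left h h0

/-- The `i`-th coordinate as a bounded operator. -/
noncomputable def L2.coordCLM (i : ℕ) : L2 A →L[ℂ] A :=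
  LinearMap.mkContinuous
    { toFun := fun x => x.coord i
      map_add' := fun _ _ => rfl
      map_smul' := fun _ _ => rfl } 1 fun x => by
    rw [one_mul]; exact L2.norm_coord_le x i

theorem L2.single_mul (i : ℕ) (a b : A) : L2.single i (a * b) = op b • L2.single i a :=
  L2.ext fun j => by
    rw [L2.coord_act]
    rcases eq_or_ne j i with rfl | h
    · simp
    · simp [L2.coord_single_of_ne _ h]

/-- The adjoint is the coordinate projection. Hence the coefficients of a locally adjointable
functional lie in `M(A)`, not merely in `RM(A)`. -/
theorem L2.isAdjointable_singleCLM (i : ℕ) : IsAdjointable A (L2.singleCLM (A := A) i) :=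
  ⟨fun a b => L2.single_mul i b a, L2.coordCLM i, fun _ _ => rfl, fun a x =>
    L2.ip_single_left i a x⟩

theorem L2.coord_sum_single (x : L2 A) (n j : ℕ) :
    (∑ i ∈ Finset.range n, L2.single i (x.coord i)).coord j = if j < n then x.coord j else 0 := by
  change L2.coordCLM j _ = _
  rw [map_sum]
  change ∑ i ∈ Finset.range n, (L2.single i (x.coord i)).coord j = _
  split_ifs with h
  · rw [Finset.sum_eq_single_of_mem j (Finset.mem_range.2 h) fun i _ hi =>
      L2.coord_single_of_ne _ hi.symm, L2.coord_single_self]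
  · exact Finset.sum_eq_zero fun i hi => L2.coord_single_of_ne _ fun hij =>
      h (hij ▸ Finset.mem_range.1 hi)

/-- The error is minus the tail of `x`; its squared norm is the norm of a tail of the convergent
series `∑ x_i^* x_i`. -/
theorem L2.tendsto_sum_single (x : L2 A) :
    Tendsto (fun n => ∑ i ∈ Finset.range n, L2.single i (x.coord i)) atTop (𝓝 x) := by
  rw [tendsto_iff_norm_sub_tendsto_zero]
  have hsq : ∀ n, ‖∑ i ∈ Finset.range n, L2.single i (x.coord i) - x‖
      = √‖∑' i, star (x.coord (i + n)) * x.coord (i + n)‖ := by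
    intro n
    set y := ∑ i ∈ Finset.range n, L2.single i (x.coord i) - x with hy
    have hc : ∀ j, y.coord j = if j < n then 0 else -x.coord j := by
      intro j
      have : y.coord j = (∑ i ∈ Finset.range n, L2.single i (x.coord i)).coord j - x.coord j := rfl
      rw [this, L2.coord_sum_single]
      split_ifs <;> simp
    rw [RightModule.norm_eq (A := A) y]
    congr 2
    change ip A y y = _
    rw [L2.ip_eq_tsum, ← y.summable_self.sum_add_tsum_nat_add n, Finset.sum_eq_zero, zero_add]
    · refine tsum_congr fun i => ?_
      rw [hc, if_neg (by lia), star_neg, neg_mul_neg]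
    · intro i hi
      rw [hc, if_pos (Finset.mem_range.1 hi), mul_zero]
  simp_rw [hsq]
  simpa using (tendsto_sum_nat_add fun i => star (x.coord i) * x.coord i).norm.sqrt

/-! ### Coefficient sequences and the functionals they define. -/

/-- The coefficients of a functional on `ℓ²(A)`. -/
noncomputable def Dual.coeff (Γ : Dual A (L2 A)) (i : ℕ) : RM A :=
  ⟨(((starₗᵢ ℂ : A ≃ₗᵢ⋆[ℂ] A) : A →L⋆[ℂ] A).comp (Γ.1 ∘L L2.singleCLM i)).comp
      ((starₗᵢ ℂ : A ≃ₗᵢ⋆[ℂ] A) : A →L⋆[ℂ] A), fun b a => by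
    -- The two stars turn the right `A`-linearity of `Γ` into the right multiplier law.
    change star (Γ.1 (L2.single i (star (b * a)))) = b * star (Γ.1 (L2.single i (star a)))
    rw [star_mul, L2.single_mul, Γ.2, op_smul_eq_mul, star_mul, star_star]⟩

theorem Dual.starMul_coeff (Γ : Dual A (L2 A)) (i : ℕ) (a : A) :
    RM.starMul (Dual.coeff Γ i) a = Γ.1 (L2.single i a) := by
  change star (star (Γ.1 (L2.single i (star (star a))))) = _
  rw [star_star, star_star]

theorem Dual.isCoeff_coeff (Γ : Dual A (L2 A)) : IsCoeff Γ (Dual.coeff Γ) := fun x => by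
  have h := (Γ.1.continuous.tendsto x).comp (L2.tendsto_sum_single x)
  simpa only [Function.comp_def, map_sum, Dual.starMul_coeff] using h

theorem RM.starMul_zero (g : RM A) : RM.starMul g 0 = 0 := by simp [RM.starMul]

/-- At a one-entry vector the partial sums are constant once `n > i`, so `Γ` determines each
coefficient. -/
theorem IsCoeff.starMul_eq {Γ : Dual A (L2 A)} {g : ℕ → RM A} (h : IsCoeff Γ g) (i : ℕ) (a : A) :
    RM.starMul (g i) a = Γ.1 (L2.single i a) := by
  refine tendsto_nhds_unique (tendsto_const_nhds.congr' ?_) (h (L2.single i a))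
  filter_upwards [eventually_gt_atTop i] with n hn
  rw [Finset.sum_eq_single_of_mem i (Finset.mem_range.2 hn) fun j _ hj => by
    rw [L2.coord_single_of_ne a hj, RM.starMul_zero], L2.coord_single_self]

theorem RM.ext_starMul {g h : RM A} (H : ∀ a, RM.starMul g a = RM.starMul h a) : g = h :=
  Subtype.ext (ContinuousLinearMap.ext fun a => by simpa [RM.starMul] using H (star a))

theorem existsUnique_isCoeff (Γ : Dual A (L2 A)) : ∃! g : ℕ → RM A, IsCoeff Γ g :=
  ⟨Dual.coeff Γ, Dual.isCoeff_coeff Γ, fun _ hg => funext fun i => RM.ext_starMul fun a => by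
    rw [hg.starMul_eq, Dual.starMul_coeff]⟩

theorem IsCoeff.defines {Γ : DualLA A (L2 A)} {g : ℕ → RM A} (h : IsCoeff ⟨Γ.1, Γ.2.1⟩ g) :
    Defines g (dualLAEquiv A (L2 A) Γ) := by
  -- The star is needed because coefficients enter the series through their adjoints: `m_i^*` must
  -- be `Γ` on the `i`-th summand.
  let m : ℕ → 𝓜(ℂ, A) := fun i => star (multiplierOfAdjointable (Γ.1 ∘L L2.singleCLM i)
    (Γ.2.2 _ (L2.isAdjointable_singleCLM i)))
  have hm : ∀ i, RM.ofMultiplier (m i) = g i := fun i => RM.ext_starMul fun a => by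
    rw [RM.starMul_ofMultiplier, h.starMul_eq, star_star]; rfl
  refine ⟨m, hm, fun β a => ?_⟩
  rw [dualLAEquiv_apply_fst]
  simpa only [← RM.starMul_ofMultiplier, hm] using h (β.1 a)

theorem Defines.isLocallyAdjointable {Γ : Dual A (L2 A)} {g : ℕ → RM A} (h : IsCoeff Γ g)
    {α : Dual 𝓜(ℂ, A) (MultiplierModule A (L2 A))} (hα : Defines g α) :
    IsLocallyAdjointable A Γ.1 := by
  obtain ⟨m, hm, hα⟩ := hα
  refine ⟨Γ.2, fun γ hγ => ?_⟩
  -- At each `a`, both sides are limits of the same partial sums.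
  have hγα : Γ.1 ∘L γ = (α.1 ⟨γ, hγ⟩).fst := ContinuousLinearMap.ext fun a => by
    refine tendsto_nhds_unique (h (γ a)) ?_
    simpa only [← RM.starMul_ofMultiplier, hm] using hα ⟨γ, hγ⟩ a
  rw [hγα]
  exact isAdjointable_fst A _

end StandardModule

end HilbertCStar

open HilbertCStar in
theorem mainTheorem1 (A : Type*) [NonUnitalCStarAlgebra A] :
    (∀ Γ : Dual A (L2 A), ∃! g : ℕ → RM A, IsCoeff Γ g) ∧
    (∀ (Γ : Dual A (L2 A)) (g : ℕ → RM A), IsCoeff Γ g →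
      (IsLocallyAdjointable A Γ.1 ↔
        ∃ α : Dual 𝓜(ℂ, A) (MultiplierModule A (L2 A)), Defines g α)) ∧
    ∃ Φ : DualLA A (L2 A) ≃ₗᵢ[ℂ] Dual 𝓜(ℂ, A) (MultiplierModule A (L2 A)),
      (∀ (Γ : DualLA A (L2 A)) (m : 𝓜(ℂ, A)), Φ (DualLA.act Γ m) = Dual.act (Φ Γ) m) ∧
      (∀ (Γ : DualLA A (L2 A)) (g : ℕ → RM A), IsCoeff ⟨Γ.1, Γ.2.1⟩ g → Defines g (Φ Γ)) :=
  ⟨existsUnique_isCoeff,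
    fun Γ _ h => ⟨fun hΓ => ⟨_, IsCoeff.defines (Γ := ⟨Γ.1, hΓ⟩) h⟩,
      fun ⟨_, hα⟩ => hα.isLocallyAdjointable h⟩,
    dualLAEquiv A (L2 A), dualLAEquiv_act, fun _ _ h => h.defines⟩
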